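/- Let $S=k[x_1,\dots,x_r]$ be a polynomial ring over a field $k$, let $I\subset S$ be an ideal generated by a set $G$ of monomials, and put $A=S/I$, which is $\mathbb Z^r$-graded by the exponents of monomials and $\mathbb Z$-graded by total degree. Write $k=A/(x_1,\dots,x_r)A$, placed in degree $0$. Let $w_1,\dots,w_r\ge 0$ be real numbers; the weight of a multidegree $a\in\mathbb Z^r$ is $w(a)=\sum_j w_ja_j$, and the weight of a homogeneous element is the weight of its multidegree. For a $\mathbb Z^r$-graded $A$-module $M$ let $t_i^A(w,M)$ be the supremum of $w(a)$ over all $a\in\mathbb Z^r$ with $\operatorname{Tor}_i^A(k,M)_a\ne0$, where $\operatorname{Tor}$ is computed from any $\mathbb Z^r$-graded free resolution of $M$ ($-\infty$ if there is no such $a$). (1) Let $M$ be a $\mathbb Z^r$-graded $A$-module generated by $\mathbb Z^r$-homogeneous elements $g_1,\dots,g_s$ of weight $\le d$, and put $J_l=\big((Ag_1+\dots+Ag_{l-1}):_A g_l\big)$ for $1\le l\le s$. Let $e,f$ be real numbers such that each ideal $J_l$ is generated by $\mathbb Z^r$-homogeneous elements of weight $\le e$ which also have weight $\le f$, and such that every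 monomial of $S$ which is a proper divisor of an element of $G$ has weight $\le f$. Then for every integer $i\ge1$, $$t_i^A(w,M)\le d+e+(i-1)f .$$ (2) Let $f\ge 2$ be an integer such that all monomials in $G$ have total degree $\le f$. Let $t_i^A(k)$ be the supremum of the integers $j$ with $\operatorname{Tor}_i^A(k,k)_j\neq0$, where $\operatorname{Tor}$ is graded by total degree and computed from any $\mathbb Z$-graded free resolution of $k$ over $A$. Then for every integer $i\ge1$, $$t_i^A(k)\le 1+(i-1)(f-1).$$ -/

import Mathlib

open scoped TensorProduct

universe u v v₁ v₂

namespace MonomialSyzygies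

/-- Generators of the ring `k[x_1,…,x_r]/I`: the image of the monomial with exponent `α`. -/
noncomputable def mono {k : Type*} [Field k] {r : ℕ} (I : Ideal (MvPolynomial (Fin r) k))
    (α : Fin r →₀ ℕ) : MvPolynomial (Fin r) k ⧸ I :=
  Ideal.Quotient.mk I (MvPolynomial.monomial α (1 : k))

/-- For a degree function `φ` on monomials with values in `Γ`, the homogeneous component of
degree `γ` of `A = k[x_1,…,x_r]/I`: the `k`-span of the monomials of degree `γ`. -/
noncomputable def ringPiece {k : Type*} [Field k] {r : ℕ} (I : Ideal (MvPolynomial (Fin r) k))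
    {Γ : Type*} (φ : (Fin r →₀ ℕ) → Γ) (γ : Γ) : AddSubgroup (MvPolynomial (Fin r) k ⧸ I) :=
  (Submodule.span k (mono I '' {α | φ α = γ})).toAddSubgroup

/-- The multidegree, in `ℤ^r`, of a monomial. -/
def multidegree {r : ℕ} (α : Fin r →₀ ℕ) : Fin r → ℤ := fun j => (α j : ℤ)

/-- The total degree of a monomial, as an integer. -/
def totalDegree {r : ℕ} (α : Fin r →₀ ℕ) : ℤ := ∑ j, (α j : ℤ)

/-- The weight `∑ w_j a_j` of a multidegree `a`. -/
def weight {r : ℕ} (w : Fin r → ℝ) (a : Fin r → ℤ) : ℝ := ∑ j, w j * (a j : ℝ)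

/-- The ideal of `A = k[x_1,…,x_r]/I` generated by the classes of the variables;
the residue field `k` of `A` is the quotient of `A` by it. -/
noncomputable def irrelevant {k : Type*} [Field k] {r : ℕ} (I : Ideal (MvPolynomial (Fin r) k)) :
    Ideal (MvPolynomial (Fin r) k ⧸ I) :=
  Ideal.span (Set.range fun j => Ideal.Quotient.mk I (MvPolynomial.X j))

/-- The grading of a module that is concentrated in degree `0`. -/
def degreeZeroPiece (M : Type*) [AddCommGroup M] {Γ : Type*} [Zero Γ] (γ : Γ) : AddSubgroup M where
  carrier := {x | γ ≠ 0 → x = 0}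
  zero_mem' := fun _ => rfl
  add_mem' := fun hx hy h => by rw [hx h, hy h, add_zero]
  neg_mem' := fun hx h => by rw [hx h, neg_zero]

section Graded

/-- `M = ⨁ M_γ` is a graded module over the graded ring with components `𝒜 γ`. -/
structure IsGradedModule {A : Type*} [CommRing A] {Γ : Type*} [AddCommGroup Γ] [DecidableEq Γ]
    (𝒜 : Γ → AddSubgroup A) {M : Type*} [AddCommGroup M] [Module A M]
    (𝓜 : Γ → AddSubgroup M) : Prop where
  isInternal : DirectSum.IsInternal 𝓜
  smul_mem : ∀ {γ δ : Γ} {x : A} {m : M}, x ∈ 𝒜 γ → m ∈ 𝓜 δ → x • m ∈ 𝓜 (γ + δ)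

/-- The component of degree `γ` of the graded free module with basis `ι`, where the basis element
with index `j` has degree `deg j`. -/
def freePiece {A : Type*} [CommRing A] {Γ : Type*} [AddCommGroup Γ] (𝒜 : Γ → AddSubgroup A)
    {ι : Type*} (deg : ι → Γ) (γ : Γ) : AddSubgroup (ι →₀ A) where
  carrier := {x | ∀ j, x j ∈ 𝒜 (γ - deg j)}
  zero_mem' := fun _ => zero_mem _
  add_mem' := fun hx hy j => add_mem (hx j) (hy j)
  neg_mem' := fun hx j => neg_mem (hx j)

/-- A graded free resolution `⋯ → F_1 → F_0 → M → 0` by graded free modules and homogeneous maps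
of degree zero; `F_n` has the basis `ι n`, with degrees `deg n`. It need not be minimal. -/
structure GradedFreeResolution.{u₁, u₂, u₃, u₄} {A : Type u₁} [CommRing A] {Γ : Type u₂}
    [AddCommGroup Γ] (𝒜 : Γ → AddSubgroup A) {M : Type u₃} [AddCommGroup M] [Module A M]
    (𝓜 : Γ → AddSubgroup M) where
  ι : ℕ → Type u₄
  deg : ∀ n, ι n → Γ
  d : ∀ n, (ι (n + 1) →₀ A) →ₗ[A] (ι n →₀ A)
  ε : (ι 0 →₀ A) →ₗ[A] M
  d_mem : ∀ n j, d n (Finsupp.single j 1) ∈ freePiece 𝒜 (deg n) (deg (n + 1) j)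
  ε_mem : ∀ j, ε (Finsupp.single j 1) ∈ 𝓜 (deg 0 j)
  ε_surjective : Function.Surjective ε
  exact_zero : LinearMap.range (d 0) = LinearMap.ker ε
  exact_succ : ∀ n, LinearMap.range (d (n + 1)) = LinearMap.ker (d n)

namespace GradedFreeResolution

variable {A : Type*} [CommRing A] {Γ : Type*} [AddCommGroup Γ] {𝒜 : Γ → AddSubgroup A}
  {M : Type*} [AddCommGroup M] [Module A M] {𝓜 : Γ → AddSubgroup M}
  (F : GradedFreeResolution 𝒜 𝓜) (𝔪 : Ideal A)

/-- The differential of the complex `(A/𝔪) ⊗ F`. -/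
noncomputable def tensorD (n : ℕ) :
    (A ⧸ 𝔪) ⊗[A] (F.ι (n + 1) →₀ A) →ₗ[A] (A ⧸ 𝔪) ⊗[A] (F.ι n →₀ A) :=
  (F.d n).lTensor (A ⧸ 𝔪)

/-- The cycles of `(A/𝔪) ⊗ F`. -/
noncomputable def cycles : ∀ i : ℕ, Submodule A ((A ⧸ 𝔪) ⊗[A] (F.ι i →₀ A))
  | 0 => ⊤
  | n + 1 => LinearMap.ker (F.tensorD 𝔪 n)

/-- The boundaries of `(A/𝔪) ⊗ F`. -/
noncomputable def boundaries (i : ℕ) : Submodule A ((A ⧸ 𝔪) ⊗[A] (F.ι i →₀ A)) :=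
  LinearMap.range (F.tensorD 𝔪 i)

/-- The component of degree `γ` of `(A/𝔪) ⊗ F_i`, where `A/𝔪` is concentrated in degree `0`. -/
noncomputable def tensorPiece (i : ℕ) (γ : Γ) : Submodule A ((A ⧸ 𝔪) ⊗[A] (F.ι i →₀ A)) :=
  Submodule.span A {z | ∃ j : F.ι i, F.deg i j = γ ∧ z = 1 ⊗ₜ[A] Finsupp.single j 1}

/-- The component of degree `γ` of `Tor_i(A/𝔪, M) = H_i((A/𝔪) ⊗ F)`: the classes, modulo
boundaries, of the homogeneous cycles of degree `γ`. -/
noncomputable def torPiece (i : ℕ) (γ : Γ) :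
    Submodule A (((A ⧸ 𝔪) ⊗[A] (F.ι i →₀ A)) ⧸ F.boundaries 𝔪 i) :=
  (F.cycles 𝔪 i ⊓ F.tensorPiece 𝔪 i γ).map (F.boundaries 𝔪 i).mkQ

/-- The maximal value (`⊥` if there is none) of `wt` on the degrees `γ` for which
`Tor_i(A/𝔪, M)_γ` is nonzero, with `Tor` computed by the resolution `F`. -/
noncomputable def t (wt : Γ → ℝ) (i : ℕ) : EReal :=
  ⨆ (γ : Γ) (_ : F.torPiece 𝔪 i γ ≠ ⊥), (wt γ : EReal)

end GradedFreeResolution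

end Graded

end MonomialSyzygies

/-!
The class of graded modules to which the bound applies is closed under taking syzygies. Let
`A = k[x_1,…,x_r]/I` be graded by an additive degree function `φ` on monomials, and let `M` have
homogeneous generators `g_l` of weight `≤ d`, finitely many and linearly ordered, such that the
colon ideal `J_l` of `g_l` with respect to its predecessors is generated by monomials `m_{l,q}` of
weight `≤ e` and `≤ f`. Each `m_{l,q}` is the leading coefficient of a homogeneous relation
`h_{l,q} = m_{l,q} e_l - ∑_{l' < l} c_{l'} e_{l'}`, of weight `≤ d + e`. Division by leading
coefficients shows that the `h_{l,q}` generate all relations (`IsLeadingSyzygies.mem_span`) and that,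
in the lexicographic order of the pairs `(l, q)`, the colon ideal of `h_{l,q}` is the colon ideal of
the monomial `m_{l,q}` with respect to the `m_{l,q'}` with `q' < q`
(`IsLeadingSyzygies.colon_syzygies`). The latter ideal is generated by divisors of the `m_{l,q'}` and
by proper divisors of the generators of `I` (`colon_span_mono`), all of weight `≤ f`. Hence the module
of relations is of the same kind, with `d + e`, `f`, `f` in place of `d`, `e`, `f`, and iteration
gives a graded free resolution `P` whose basis elements in position `i ≥ 1` have weight
`≤ d + e + (i - 1) f` (`exists_resolution_of_hasMonomialColons`).

An arbitrary graded free resolution `F` is compared with `P`: the identity of `F` is homotopic to a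
composite `F → P → F` whose first map preserves degrees, and in degree `γ` this first map vanishes
modulo the ideal of the variables unless `P` has a basis element of degree `γ`. So `Tor_i` computed
by `F` lives in the degrees of the basis of `P_i` (`GradedFreeResolution.torPiece_eq_bot`).

For the multigrading, multihomogeneous elements of `A` are multiples of monomials. The residue field
with its total grading has one generator, of degree zero, whose colon ideal is generated by the
variables; here `d = 0`, `e = 1`, and `f - 1` takes the place of `f`.
-/

namespace MonomialSyzygies

/-! ### Homogeneous components -/

section Components

variable {A : Type*} [CommRing A] {Γ : Type*} [AddCommGroup Γ]

/-- The maps `π δ` are the projections of the graded ring `A` onto its components `𝒜 δ`. The law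
`map_mul` says that taking components commutes with multiplication by homogeneous elements. -/
structure IsRingProjection (𝒜 : Γ → AddSubgroup A) (π : Γ → A →+ A) : Prop where
  mem : ∀ δ c, π δ c ∈ 𝒜 δ
  eq_self : ∀ {δ x}, x ∈ 𝒜 δ → π δ x = x
  eq_zero : ∀ {γ δ x}, x ∈ 𝒜 δ → δ ≠ γ → π γ x = 0
  map_mul : ∀ γ {a} (c) {x}, x ∈ 𝒜 a → π γ (c * x) = π (γ - a) c * x

/-- The module `M` has projections onto its homogeneous components, compatible with the projections
`π` of the ring. Only the existence is recorded, which is all that lifting needs. -/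
def HasProjection (π : Γ → A →+ A) {M : Type*} [AddCommGroup M] [Module A M]
    (𝓜 : Γ → AddSubgroup M) : Prop :=
  ∃ p : Γ → M →+ M, (∀ γ x, x ∈ 𝓜 γ → p γ x = x) ∧
    ∀ γ a c g, g ∈ 𝓜 a → p γ (c • g) = π (γ - a) c • g

variable {𝒜 : Γ → AddSubgroup A} {π : Γ → A →+ A}

theorem IsRingProjection.mul_mem (hπ : IsRingProjection 𝒜 π) {a b : Γ} {x y : A}
    (hx : x ∈ 𝒜 a) (hy : y ∈ 𝒜 b) : x * y ∈ 𝒜 (a + b) := by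
  have h := hπ.map_mul (a + b) x hy
  rw [add_sub_cancel_right, hπ.eq_self hx] at h
  exact h ▸ hπ.mem _ _

theorem IsRingProjection.smul_mem_freePiece (hπ : IsRingProjection 𝒜 π) {ι : Type*} {deg : ι → Γ}
    {a b : Γ} {c : A} {x : ι →₀ A} (hc : c ∈ 𝒜 a) (hx : x ∈ freePiece 𝒜 deg b) :
    c • x ∈ freePiece 𝒜 deg (a + b) := fun j => by
  have := hπ.mul_mem hc (hx j)
  rwa [← add_sub_assoc] at this

/-- The coordinatewise projection onto the component of degree `γ` of a graded free module. -/
noncomputable def freeProj (π : Γ → A →+ A) {ι : Type*} (deg : ι → Γ) (γ : Γ) :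
    (ι →₀ A) →+ (ι →₀ A) where
  toFun x :=
    Finsupp.onFinset x.support (fun j => π (γ - deg j) (x j))
      (fun j hj => by
        rw [Finsupp.mem_support_iff]
        rintro h
        exact hj (by rw [h, map_zero]))
  map_zero' := by ext j; simp
  map_add' x y := by ext j; simp

theorem freeProj_apply {ι : Type*} (deg : ι → Γ) (γ : Γ) (x : ι →₀ A) (j : ι) :
    freeProj π deg γ x j = π (γ - deg j) (x j) := rfl

theorem IsRingProjection.freeProj_mem (hπ : IsRingProjection 𝒜 π) {ι : Type*} (deg : ι → Γ) (γ : Γ)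
    (x : ι →₀ A) : freeProj π deg γ x ∈ freePiece 𝒜 deg γ := fun _ => hπ.mem _ _

theorem IsRingProjection.hasProjection_freePiece (hπ : IsRingProjection 𝒜 π) {ι : Type*}
    (deg : ι → Γ) : HasProjection π (freePiece 𝒜 deg) := by
  refine ⟨freeProj π deg, fun γ x hx => ?_, fun γ a c g hg => ?_⟩
  · ext j
    exact hπ.eq_self (hx j)
  · ext j
    rw [freeProj_apply, Finsupp.smul_apply, smul_eq_mul, hπ.map_mul _ _ (hg j)]
    simp

variable {M : Type*} [AddCommGroup M] [Module A M] {𝓜 : Γ → AddSubgroup M}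

/-- A homogeneous element that is a linear combination of homogeneous elements remains the same
linear combination when the coefficients are replaced by their components of the right degree. -/
theorem HasProjection.linearCombination_freeProj (hM : HasProjection π 𝓜) {ι : Type*} {g : ι → M}
    {deg : ι → Γ} (hg : ∀ j, g j ∈ 𝓜 (deg j)) {γ : Γ} {c : ι →₀ A}
    (hc : Finsupp.linearCombination A g c ∈ 𝓜 γ) :
    Finsupp.linearCombination A g (freeProj π deg γ c) = Finsupp.linearCombination A g c := by
  obtain ⟨p, hp, hps⟩ := hM
  rw [← hp γ _ hc]
  clear hc
  induction c using Finsupp.induction_linear with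
  | zero => simp
  | add x y hx hy => simp only [map_add, hx, hy]
  | single j c =>
    have : freeProj π deg γ (Finsupp.single j c) = Finsupp.single j (π (γ - deg j) c) := by
      ext i
      rw [freeProj_apply]
      by_cases h : j = i
      · subst h; simp
      · simp [Finsupp.single_eq_of_ne' h]
    rw [this, Finsupp.linearCombination_single, Finsupp.linearCombination_single, hps _ _ _ _ (hg j)]

/-- A homogeneous element in the image of a graded free module has a homogeneous preimage. -/
theorem exists_mem_freePiece_of_mem_range (hπ : IsRingProjection 𝒜 π) (hM : HasProjection π 𝓜)
    {ι : Type*} {deg : ι → Γ} (D : (ι →₀ A) →ₗ[A] M) (hD : ∀ j, D (Finsupp.single j 1) ∈ 𝓜 (deg j))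
    {γ : Γ} {x : M} (hx : x ∈ 𝓜 γ) (hxD : x ∈ LinearMap.range D) :
    ∃ c ∈ freePiece 𝒜 deg γ, D c = x := by
  obtain ⟨c, rfl⟩ := hxD
  have hlin : D = Finsupp.linearCombination A (fun j => D (Finsupp.single j 1)) := by
    ext j; simp
  rw [hlin] at hx
  refine ⟨freeProj π deg γ c, hπ.freeProj_mem _ _ _, ?_⟩
  have := hM.linearCombination_freeProj hD hx
  rwa [← hlin] at this

/-- A linear map that sends the basis to homogeneous elements of the right degree preserves
degrees. -/
theorem IsRingProjection.map_mem_freePiece (hπ : IsRingProjection 𝒜 π) {ι κ : Type*} {deg : ι → Γ}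
    {deg' : κ → Γ} {α : (ι →₀ A) →ₗ[A] (κ →₀ A)}
    (hα : ∀ j, α (Finsupp.single j 1) ∈ freePiece 𝒜 deg' (deg j)) {γ : Γ} {x : ι →₀ A}
    (hx : x ∈ freePiece 𝒜 deg γ) : α x ∈ freePiece 𝒜 deg' γ := by
  have : α x = x.sum fun j c => c • α (Finsupp.single j 1) := by
    conv_lhs => rw [← Finsupp.sum_single x]
    rw [Finsupp.sum, map_sum]
    refine Finset.sum_congr rfl fun j _ => ?_
    simp only [← map_smul, Finsupp.smul_single_one]
  rw [this]
  refine sum_mem fun j _ => ?_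
  have := hπ.smul_mem_freePiece (hx j) (hα j)
  rwa [sub_add_cancel] at this

end Components

/-! ### Comparison of resolutions -/

section Comparison

/-- Dependent choice along `ℕ`, for a family of types: an invariant `C` that can be continued by a
step satisfying `R` yields an infinite sequence. -/
theorem exists_seq_of_forall_exists_step {T : ℕ → Type*} (C : ∀ n, T n → Prop)
    (R : ∀ n, T n → T (n + 1) → Prop) {x₀ : T 0} (h0 : C 0 x₀)
    (hs : ∀ n x, C n x → ∃ y, C (n + 1) y ∧ R n x y) :
    ∃ f : ∀ n, T n, f 0 = x₀ ∧ (∀ n, C n (f n)) ∧ ∀ n, R n (f n) (f (n + 1)) := by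
  choose next hC hR using hs
  let f : ∀ n, {x : T n // C n x} := fun n =>
    Nat.rec ⟨x₀, h0⟩ (fun n x => ⟨next n x.1 x.2, hC n x.1 x.2⟩) n
  exact ⟨fun n => (f n).1, rfl, fun n => (f n).2, fun n => hR n (f n).1 (f n).2⟩

/-- A linear map out of a free module can be prescribed on the basis, subject to a lifting
condition and a property of the values. -/
theorem exists_lift_of_forall_single {A : Type*} [CommRing A] {ι M N : Type*} [AddCommGroup M]
    [Module A M] [AddCommGroup N] [Module A N] (D : M →ₗ[A] N) (f : (ι →₀ A) →ₗ[A] N)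
    (p : ι → M → Prop) (h : ∀ j, ∃ y, p j y ∧ D y = f (Finsupp.single j 1)) :
    ∃ α : (ι →₀ A) →ₗ[A] M, (∀ j, p j (α (Finsupp.single j 1))) ∧ D ∘ₗ α = f := by
  choose y hy hDy using h
  refine ⟨Finsupp.linearCombination A y, fun j => by simpa using hy j, ?_⟩
  ext j
  simp [hDy]

namespace GradedFreeResolution

variable {A : Type*} [CommRing A] {Γ : Type*} [AddCommGroup Γ] {𝒜 : Γ → AddSubgroup A}
  {M : Type*} [AddCommGroup M] [Module A M] {𝓜 : Γ → AddSubgroup M}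

theorem d_comp_d (F : GradedFreeResolution 𝒜 𝓜) (n : ℕ) (x) : F.d n (F.d (n + 1) x) = 0 :=
  LinearMap.mem_ker.1 (F.exact_succ n ▸ LinearMap.mem_range_self _ x)

theorem ε_comp_d (F : GradedFreeResolution 𝒜 𝓜) (x) : F.ε (F.d 0 x) = 0 :=
  LinearMap.mem_ker.1 (F.exact_zero ▸ LinearMap.mem_range_self _ x)

/-- The identity of `M` lifts to a chain map between two resolutions; the values on the basis can be
taken in any prescribed sets `p` in which preimages can be found. -/
theorem exists_chainMap_of_lift (F P : GradedFreeResolution 𝒜 𝓜)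
    (p : ∀ n, F.ι n → (P.ι n →₀ A) → Prop)
    (h0 : ∀ j, ∃ y, p 0 j y ∧ P.ε y = F.ε (Finsupp.single j 1))
    (hs : ∀ n (α : (F.ι n →₀ A) →ₗ[A] (P.ι n →₀ A)), (∀ j, p n j (α (Finsupp.single j 1))) →
      ∀ j, α (F.d n (Finsupp.single j 1)) ∈ LinearMap.range (P.d n) →
        ∃ y, p (n + 1) j y ∧ P.d n y = α (F.d n (Finsupp.single j 1))) :
    ∃ α : ∀ n, (F.ι n →₀ A) →ₗ[A] (P.ι n →₀ A), (∀ n j, p n j (α n (Finsupp.single j 1))) ∧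
      P.ε ∘ₗ α 0 = F.ε ∧ ∀ n, P.d n ∘ₗ α (n + 1) = α n ∘ₗ F.d n := by
  obtain ⟨α₀, hα₀, hα₀'⟩ := exists_lift_of_forall_single P.ε F.ε (p 0) h0
  obtain ⟨α, hα0, hα, hR⟩ := exists_seq_of_forall_exists_step
    (T := fun n => (F.ι n →₀ A) →ₗ[A] (P.ι n →₀ A))
    (fun n α => (∀ j, p n j (α (Finsupp.single j 1))) ∧
      ∀ x, α (F.d n x) ∈ LinearMap.range (P.d n))
    (fun n α α' => P.d n ∘ₗ α' = α ∘ₗ F.d n)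
    (x₀ := α₀) ⟨hα₀, fun x => by
      rw [P.exact_zero, LinearMap.mem_ker, ← LinearMap.comp_apply, hα₀', F.ε_comp_d]⟩
    (fun n α hα => by
      obtain ⟨β, hβ, hβ'⟩ := exists_lift_of_forall_single (P.d n) (α ∘ₗ F.d n) (p (n + 1))
        (fun j => hs n α hα.1 j (hα.2 _))
      refine ⟨β, ⟨hβ, fun x => ?_⟩, hβ'⟩
      rw [P.exact_succ, LinearMap.mem_ker, ← LinearMap.comp_apply, hβ', LinearMap.comp_apply,
        F.d_comp_d, map_zero])
  refine ⟨α, fun n => (hα n).1, ?_, hR⟩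
  rw [hα0, hα₀']

/-- Any two resolutions are compared by a chain map. -/
theorem exists_chainMap (F P : GradedFreeResolution 𝒜 𝓜) :
    ∃ α : ∀ n, (F.ι n →₀ A) →ₗ[A] (P.ι n →₀ A),
      P.ε ∘ₗ α 0 = F.ε ∧ ∀ n, P.d n ∘ₗ α (n + 1) = α n ∘ₗ F.d n := by
  obtain ⟨α, -, h⟩ := exists_chainMap_of_lift F P (fun _ _ _ => True)
    (fun j => by simpa using P.ε_surjective _) (fun n α _ j hj => by simpa using hj)
  exact ⟨α, h⟩

/-- Any two graded resolutions are compared by a chain map that preserves degrees. -/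
theorem exists_graded_chainMap {π : Γ → A →+ A} (hπ : IsRingProjection 𝒜 π)
    (hM : HasProjection π 𝓜) (F P : GradedFreeResolution 𝒜 𝓜) :
    ∃ α : ∀ n, (F.ι n →₀ A) →ₗ[A] (P.ι n →₀ A),
      (∀ n j, α n (Finsupp.single j 1) ∈ freePiece 𝒜 (P.deg n) (F.deg n j)) ∧
      P.ε ∘ₗ α 0 = F.ε ∧ ∀ n, P.d n ∘ₗ α (n + 1) = α n ∘ₗ F.d n :=
  exists_chainMap_of_lift F P (fun n j y => y ∈ freePiece 𝒜 (P.deg n) (F.deg n j))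
    (fun j => exists_mem_freePiece_of_mem_range hπ hM P.ε P.ε_mem (F.ε_mem j) (P.ε_surjective _))
    (fun n _ hα j => exists_mem_freePiece_of_mem_range hπ (hπ.hasProjection_freePiece _) (P.d n)
      (P.d_mem n) (hπ.map_mem_freePiece hα (F.d_mem n j)))

/-- A chain endomorphism of a resolution that lifts the zero map of `M` is null-homotopic. -/
theorem exists_homotopy (F : GradedFreeResolution 𝒜 𝓜)
    (θ : ∀ n, (F.ι n →₀ A) →ₗ[A] (F.ι n →₀ A)) (h0 : F.ε ∘ₗ θ 0 = 0)
    (hθ : ∀ n, F.d n ∘ₗ θ (n + 1) = θ n ∘ₗ F.d n) :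
    ∃ h : ∀ n, (F.ι n →₀ A) →ₗ[A] (F.ι (n + 1) →₀ A),
      ∀ n, F.d (n + 1) ∘ₗ h (n + 1) = θ (n + 1) - h n ∘ₗ F.d n := by
  obtain ⟨h₀, -, hh₀⟩ := exists_lift_of_forall_single (F.d 0) (θ 0) (fun _ _ => True)
    (fun j => by
      have : θ 0 (Finsupp.single j 1) ∈ LinearMap.range (F.d 0) := by
        rw [F.exact_zero, LinearMap.mem_ker, ← LinearMap.comp_apply, h0, LinearMap.zero_apply]
      simpa using this)
  obtain ⟨h, -, -, hR⟩ := exists_seq_of_forall_exists_step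
    (T := fun n => (F.ι n →₀ A) →ₗ[A] (F.ι (n + 1) →₀ A))
    (fun n h => F.d n ∘ₗ h ∘ₗ F.d n = θ n ∘ₗ F.d n)
    (fun n h h' => F.d (n + 1) ∘ₗ h' = θ (n + 1) - h ∘ₗ F.d n)
    (x₀ := h₀) (by rw [← LinearMap.comp_assoc, hh₀])
    (fun n h hh => by
      obtain ⟨h', -, hh'⟩ := exists_lift_of_forall_single (F.d (n + 1))
        (θ (n + 1) - h ∘ₗ F.d n) (fun _ _ => True)
        (fun j => by
          have : (θ (n + 1) - h ∘ₗ F.d n) (Finsupp.single j 1) ∈ LinearMap.range (F.d (n + 1)) := by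
            rw [F.exact_succ, LinearMap.mem_ker, ← LinearMap.comp_apply, LinearMap.comp_sub, hθ, hh,
              LinearMap.sub_apply, sub_self]
          simpa using this)
      refine ⟨h', ?_, hh'⟩
      ext1 j
      ext1
      have := congrArg (fun f => f (F.d (n + 1) (Finsupp.single j 1))) hh'
      simpa [F.d_comp_d] using this)
  exact ⟨h, hR⟩

/-- If some resolution `P` has no basis element of degree `γ` in position `n + 1`, then
`Tor` vanishes in that position and degree, whichever resolution `F` computes it: the identity of
`F` is homotopic to a map through `P`, and after tensoring the map `F → P` is zero in degree `γ`. -/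
theorem torPiece_eq_bot {π : Γ → A →+ A} (hπ : IsRingProjection 𝒜 π) (hM : HasProjection π 𝓜)
    {𝔪 : Ideal A} (h𝔪 : ∀ δ, δ ≠ 0 → ∀ x ∈ 𝒜 δ, x ∈ 𝔪) (F P : GradedFreeResolution 𝒜 𝓜) (n : ℕ)
    (γ : Γ) (hγ : ∀ j, P.deg (n + 1) j ≠ γ) : F.torPiece 𝔪 (n + 1) γ = ⊥ := by
  obtain ⟨α, hαdeg, hα0, hα⟩ := exists_graded_chainMap hπ hM F P
  obtain ⟨β, hβ0, hβ⟩ := exists_chainMap P F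
  obtain ⟨h, hh⟩ := F.exists_homotopy (fun n => β n ∘ₗ α n - LinearMap.id)
    (by rw [LinearMap.comp_sub, ← LinearMap.comp_assoc, hβ0, hα0, LinearMap.comp_id, sub_self])
    (fun n => by
      rw [LinearMap.comp_sub, ← LinearMap.comp_assoc, hβ, LinearMap.comp_assoc, hα,
        LinearMap.sub_comp, LinearMap.comp_assoc, LinearMap.comp_id, LinearMap.id_comp])
  have hαz : ∀ z ∈ F.tensorPiece 𝔪 (n + 1) γ, (α (n + 1)).lTensor (A ⧸ 𝔪) z = 0 := by
    intro z hz
    refine LinearMap.mem_ker.1 ((Submodule.span_le.2 ?_) hz)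
    rintro _ ⟨j, rfl, rfl⟩
    rw [SetLike.mem_coe, LinearMap.mem_ker, LinearMap.lTensor_tmul,
      ← Finsupp.sum_single (α (n + 1) (Finsupp.single j 1)), Finsupp.sum, TensorProduct.tmul_sum]
    refine Finset.sum_eq_zero fun i _ => ?_
    -- The coefficient at `i` lies in `𝔪`, since its degree is not zero.
    have hi := h𝔪 _ (sub_ne_zero.2 (hγ i).symm) _ (hαdeg (n + 1) j i)
    rw [← Finsupp.smul_single_one, ← TensorProduct.smul_tmul, ← Algebra.algebraMap_eq_smul_one,
      Ideal.Quotient.algebraMap_eq, Ideal.Quotient.eq_zero_iff_mem.2 hi, TensorProduct.zero_tmul]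
  rw [torPiece, eq_bot_iff, Submodule.map_le_iff_le_comap, Submodule.comap_bot, Submodule.ker_mkQ]
  rintro z ⟨hz, hzγ⟩
  have hz : (F.d n).lTensor (A ⧸ 𝔪) z = 0 := hz
  have key := congrArg (fun f => LinearMap.lTensor (A ⧸ 𝔪) f z) (hh n)
  simp only [LinearMap.lTensor_sub, LinearMap.lTensor_comp, LinearMap.sub_apply,
    LinearMap.comp_apply, hz, hαz z hzγ, LinearMap.lTensor_id, LinearMap.id_apply, map_zero,
    sub_zero, zero_sub] at key
  exact ⟨-(h (n + 1)).lTensor (A ⧸ 𝔪) z, by rw [map_neg, tensorD, key, neg_neg]⟩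

end GradedFreeResolution

end Comparison

/-! ### The graded ring `k[x_1,…,x_r]/I` of a monomial ideal -/

section MonomialRing

open MvPolynomial

variable {k : Type*} [Field k] {r : ℕ} {I : Ideal (MvPolynomial (Fin r) k)}

theorem mono_mul (I : Ideal (MvPolynomial (Fin r) k)) (α β : Fin r →₀ ℕ) :
    mono I α * mono I β = mono I (α + β) := by
  rw [mono, mono, ← map_mul, monomial_mul, one_mul, mono]

theorem mono_zero (I : Ideal (MvPolynomial (Fin r) k)) : mono I 0 = 1 := by
  rw [mono, ← C_apply, map_one, map_one]

variable {Γ : Type*} {φ : (Fin r →₀ ℕ) → Γ}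

theorem mono_mem_ringPiece (I : Ideal (MvPolynomial (Fin r) k)) (φ : (Fin r →₀ ℕ) → Γ)
    (α : Fin r →₀ ℕ) : mono I α ∈ ringPiece I φ (φ α) :=
  Submodule.subset_span ⟨α, rfl, rfl⟩

/-- Every element of the ring is a sum of homogeneous ones. -/
theorem ringPiece_induction (I : Ideal (MvPolynomial (Fin r) k)) (φ : (Fin r →₀ ℕ) → Γ)
    {P : (MvPolynomial (Fin r) k ⧸ I) → Prop} (homogeneous : ∀ δ, ∀ x ∈ ringPiece I φ δ, P x)
    (add : ∀ x y, P x → P y → P (x + y)) (x : MvPolynomial (Fin r) k ⧸ I) : P x := by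
  obtain ⟨x, rfl⟩ := Ideal.Quotient.mk_surjective x
  rw [x.as_sum, map_sum]
  refine Finset.sum_induction _ P add (homogeneous (φ 0) 0 (zero_mem _)) fun α _ => ?_
  refine homogeneous (φ α) _ ?_
  have : Ideal.Quotient.mk I (monomial α (coeff α x)) = coeff α x • mono I α := by
    rw [mono, ← Ideal.Quotient.mkₐ_eq_mk k, ← map_smul, smul_monomial, smul_eq_mul, mul_one]
  rw [this]
  exact Submodule.smul_mem _ _ (mono_mem_ringPiece I φ α)

open Classical in
/-- The projection of the polynomial ring onto the span of the monomials of degree `δ`. -/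
noncomputable def polyProj (k : Type*) [Field k] {r : ℕ} (φ : (Fin r →₀ ℕ) → Γ) (δ : Γ) :
    MvPolynomial (Fin r) k →ₗ[k] MvPolynomial (Fin r) k :=
  (basisMonomials (Fin r) k).constr k fun α => if φ α = δ then monomial α 1 else 0

open Classical in
theorem polyProj_monomial (φ : (Fin r →₀ ℕ) → Γ) (δ : Γ) (α : Fin r →₀ ℕ) :
    polyProj k φ δ (monomial α 1) = if φ α = δ then monomial α 1 else 0 := by
  have h := congrFun (coe_basisMonomials (Fin r) k) α
  rw [polyProj]
  nth_rewrite 1 [← h]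
  rw [Module.Basis.constr_basis]

/-- A monomial ideal contains the homogeneous components of its elements. -/
theorem polyProj_mem {G : Set (Fin r →₀ ℕ)}
    (hI : I = Ideal.span ((fun α => monomial α (1 : k)) '' G)) (δ : Γ) {x : MvPolynomial (Fin r) k}
    (hx : x ∈ I) : polyProj k φ δ x ∈ I := by
  have hx' := hx
  rw [hI, mem_ideal_span_monomial_image] at hx'
  rw [x.as_sum, map_sum]
  refine sum_mem fun α hα => ?_
  rw [show monomial α (coeff α x) = coeff α x • monomial α (1 : k) by simp [smul_monomial],
    map_smul, polyProj_monomial]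
  refine Submodule.smul_of_tower_mem I _ ?_
  split_ifs
  · rw [hI, mem_ideal_span_monomial_image]
    intro β hβ
    rw [Finset.mem_singleton.1 (support_monomial_subset hβ)]
    exact hx' α hα
  · exact zero_mem _

variable [AddCommGroup Γ]

theorem mul_mem_ringPiece (hφ : ∀ α β, φ (α + β) = φ α + φ β) {γ δ : Γ}
    {x y : MvPolynomial (Fin r) k ⧸ I} (hx : x ∈ ringPiece I φ γ) (hy : y ∈ ringPiece I φ δ) :
    x * y ∈ ringPiece I φ (γ + δ) := by
  have h := Submodule.mul_mem_mul (R := k) hx hy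
  rw [Submodule.span_mul_span] at h
  refine Submodule.span_mono ?_ h
  rintro _ ⟨_, ⟨α, rfl, rfl⟩, _, ⟨β, rfl, rfl⟩, rfl⟩
  exact ⟨α + β, hφ α β, (mono_mul I α β).symm⟩

/-- The ring `k[x_1,…,x_r]/I` of a monomial ideal is graded by every additive degree function. -/
theorem exists_isRingProjection {G : Set (Fin r →₀ ℕ)}
    (hI : I = Ideal.span ((fun α => monomial α (1 : k)) '' G))
    (hφ : ∀ α β, φ (α + β) = φ α + φ β) :
    ∃ π : Γ → (MvPolynomial (Fin r) k ⧸ I) →+ (MvPolynomial (Fin r) k ⧸ I),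
      IsRingProjection (ringPiece I φ) π := by
  let N : Submodule k (MvPolynomial (Fin r) k) := I.restrictScalars k
  let q : Γ → (MvPolynomial (Fin r) k ⧸ I) →ₗ[k] (MvPolynomial (Fin r) k ⧸ I) := fun δ =>
    Submodule.mapQ N N (polyProj k φ δ) fun x hx => polyProj_mem hI δ hx
  have hq : ∀ δ x, q δ (Ideal.Quotient.mk I x) = Ideal.Quotient.mk I (polyProj k φ δ x) :=
    fun _ _ => rfl
  have hself : ∀ {δ x}, x ∈ ringPiece I φ δ → q δ x = x := by
    intro δ x hx
    refine (Submodule.span_le (p := LinearMap.eqLocus (q δ) LinearMap.id)).2 ?_ hx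
    rintro _ ⟨α, hα, rfl⟩
    change q δ (mono I α) = mono I α
    rw [mono, hq, polyProj_monomial, if_pos (show φ α = δ from hα)]
  have hzero : ∀ {γ δ x}, x ∈ ringPiece I φ δ → δ ≠ γ → q γ x = 0 := by
    intro γ δ x hx h
    refine (Submodule.span_le (p := LinearMap.ker (q γ))).2 ?_ hx
    rintro _ ⟨α, rfl, rfl⟩
    rw [SetLike.mem_coe, LinearMap.mem_ker, mono, hq, polyProj_monomial, if_neg h, map_zero]
  refine ⟨fun δ => (q δ).toAddMonoidHom, fun δ c => ?_, hself, hzero, fun γ a c x hx => ?_⟩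
  · change q δ c ∈ ringPiece I φ δ
    induction c using ringPiece_induction I φ with
    | homogeneous γ c hc =>
      by_cases h : γ = δ
      · subst h
        rwa [hself hc]
      · rw [hzero hc h]
        exact zero_mem _
    | add x y hx hy => rw [map_add]; exact add_mem hx hy
  · change q γ (c * x) = q (γ - a) c * x
    induction c using ringPiece_induction I φ with
    | homogeneous δ c hc =>
      have hmem := mul_mem_ringPiece hφ hc hx
      by_cases h : δ = γ - a
      · subst h
        rw [sub_add_cancel] at hmem
        rw [hself hc, hself hmem]
      · rw [hzero hc h, zero_mul, hzero hmem fun h' => h (eq_sub_of_add_eq h')]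
    | add b c hb hc => rw [add_mul, map_add, hb, hc, map_add, add_mul]

theorem mono_mem_irrelevant {α : Fin r →₀ ℕ} (hα : α ≠ 0) : mono I α ∈ irrelevant I := by
  obtain ⟨j, hj⟩ := DFunLike.ne_iff.1 hα
  have h : Finsupp.single j 1 ≤ α := Finsupp.single_le_iff.2 (Nat.one_le_iff_ne_zero.2 hj)
  rw [← tsub_add_cancel_of_le h, ← mono_mul]
  exact Ideal.mul_mem_left _ _ (Ideal.subset_span ⟨j, rfl⟩)

theorem mem_irrelevant_of_mem_ringPiece (hφ0 : φ 0 = 0) {δ : Γ} (hδ : δ ≠ 0)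
    {x : MvPolynomial (Fin r) k ⧸ I} (hx : x ∈ ringPiece I φ δ) : x ∈ irrelevant I := by
  refine (Submodule.span_le (p := (irrelevant I).restrictScalars k)).2 ?_ hx
  rintro _ ⟨α, hα, rfl⟩
  refine mono_mem_irrelevant ?_
  rintro rfl
  exact hδ (hφ0 ▸ hα.symm)

/-- A graded module has projections onto its components. -/
theorem IsGradedModule.hasProjection [DecidableEq Γ]
    {π : Γ → (MvPolynomial (Fin r) k ⧸ I) →+ (MvPolynomial (Fin r) k ⧸ I)}
    (hπ : IsRingProjection (ringPiece I φ) π)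
    {M : Type*} [AddCommGroup M] [Module (MvPolynomial (Fin r) k ⧸ I) M] {𝓜 : Γ → AddSubgroup M}
    (hM : IsGradedModule (ringPiece I φ) 𝓜) : HasProjection π 𝓜 := by
  let := hM.isInternal.chooseDecomposition
  let p : Γ → M →+ M := fun γ =>
    { toFun := fun x => (DirectSum.decompose 𝓜 x γ : M)
      map_zero' := by simp
      map_add' := fun x y => by simp }
  have hp : ∀ γ x, x ∈ 𝓜 γ → p γ x = x := fun γ x hx => DirectSum.decompose_of_mem_same 𝓜 hx
  have hp0 : ∀ γ δ x, x ∈ 𝓜 δ → δ ≠ γ → p γ x = 0 := fun γ δ x hx h =>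
    DirectSum.decompose_of_mem_ne 𝓜 hx h
  refine ⟨p, hp, fun γ a c g hg => ?_⟩
  induction c using ringPiece_induction I φ with
  | add x y hx hy => rw [add_smul, map_add, hx, hy, map_add, add_smul]
  | homogeneous δ c hc =>
    have hmem := hM.smul_mem hc hg
    by_cases h : δ = γ - a
    · subst h
      rw [sub_add_cancel] at hmem
      rw [hπ.eq_self hc, hp _ _ hmem]
    · rw [hπ.eq_zero hc h, hp0 _ _ _ hmem fun h' => h (eq_sub_of_add_eq h')]
      exact (zero_smul (MvPolynomial (Fin r) k ⧸ I) g).symm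

/-- The residue field, concentrated in degree zero, has projections onto its components. -/
theorem hasProjection_degreeZeroPiece (hφ0 : φ 0 = 0)
    {π : Γ → (MvPolynomial (Fin r) k ⧸ I) →+ (MvPolynomial (Fin r) k ⧸ I)}
    (hπ : IsRingProjection (ringPiece I φ) π) :
    HasProjection π
      (degreeZeroPiece ((MvPolynomial (Fin r) k ⧸ I) ⧸ irrelevant I) (Γ := Γ)) := by
  classical
  refine ⟨fun γ => if γ = 0 then AddMonoidHom.id _ else 0, fun γ x hx => ?_, fun γ a c g hg => ?_⟩
  · by_cases h : γ = 0
    · simp [h]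
    · simpa [h] using (hx h).symm
  · have hkill : ∀ c ∈ irrelevant I, c • g = 0 := fun c hc => by
      obtain ⟨g, rfl⟩ := Ideal.Quotient.mk_surjective g
      exact Ideal.Quotient.eq_zero_iff_mem.2 (Ideal.mul_mem_right g _ hc)
    by_cases ha : a = 0
    · subst ha
      rw [sub_zero]
      induction c using ringPiece_induction I φ with
      | add x y hx hy => rw [add_smul, map_add, hx, hy, map_add, add_smul]
      | homogeneous δ c hc =>
        by_cases hδ : δ = 0
        · subst hδ
          by_cases hγ : γ = 0
          · subst hγ
            simp [hπ.eq_self hc]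
          · rw [hπ.eq_zero hc (Ne.symm hγ)]
            simp only [if_neg hγ, AddMonoidHom.zero_apply]
            exact (zero_smul (MvPolynomial (Fin r) k ⧸ I) g).symm
        · rw [hkill c (mem_irrelevant_of_mem_ringPiece hφ0 hδ hc), map_zero]
          by_cases h : δ = γ
          · subst h
            rw [hπ.eq_self hc, hkill c (mem_irrelevant_of_mem_ringPiece hφ0 hδ hc)]
          · rw [hπ.eq_zero hc h]
            exact (zero_smul (MvPolynomial (Fin r) k ⧸ I) g).symm
    · rw [hg ha, smul_zero, smul_zero, map_zero]

/-- The colon of a monomial ideal by a monomial `β` in `k[x_1,…,x_r]/I` is generated by the quotients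
`τ - β` (truncated) of the generators `τ` of that ideal and of the generators `n` of `I` by their
greatest common divisors with `β`. An `n` coprime to `β` contributes nothing, being zero in the
ring, so that only proper divisors of the generators of `I` occur. -/
theorem colon_span_mono {G : Set (Fin r →₀ ℕ)}
    (hI : I = Ideal.span ((fun α => monomial α (1 : k)) '' G)) (T : Set (Fin r →₀ ℕ))
    (β : Fin r →₀ ℕ) :
    (Ideal.span (mono I '' T)).colon {mono I β} =
      Ideal.span (mono I '' ({α | ∃ τ ∈ T, α = τ - β} ∪ {α | ∃ n ∈ G, α ≠ n ∧ α = n - β})) := by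
  have hlift : ∀ x : MvPolynomial (Fin r) k, Ideal.Quotient.mk I x ∈ Ideal.span (mono I '' T) ↔
      x ∈ Ideal.span ((fun α => monomial α (1 : k)) '' (T ∪ G)) := by
    intro x
    rw [Set.image_union, Ideal.span_union, ← hI, show mono I '' T =
      Ideal.Quotient.mk I '' ((fun α => monomial α (1 : k)) '' T) by rw [Set.image_image]; rfl,
      ← Ideal.map_span, ← Ideal.mem_comap,
      Ideal.comap_map_of_surjective' _ Ideal.Quotient.mk_surjective, Ideal.mk_ker]
  apply le_antisymm
  · intro x hx
    obtain ⟨x, rfl⟩ := Ideal.Quotient.mk_surjective x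
    rw [Submodule.mem_colon_singleton, smul_eq_mul, mono, ← map_mul, hlift,
      mem_ideal_span_monomial_image] at hx
    rw [x.as_sum, map_sum]
    refine sum_mem fun α hα => ?_
    obtain ⟨τ, hτ, hle⟩ := hx (α + β) (by
      rw [mem_support_iff, coeff_mul_monomial, mul_one]
      exact mem_support_iff.1 hα)
    have hle : τ - β ≤ α := tsub_le_iff_right.2 hle
    have hmem : mono I (τ - β) ∈ Ideal.span
        (mono I '' ({α | ∃ τ ∈ T, α = τ - β} ∪ {α | ∃ n ∈ G, α ≠ n ∧ α = n - β})) := by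
      rcases hτ with hτ | hτ
      · exact Ideal.subset_span ⟨_, Or.inl ⟨τ, hτ, rfl⟩, rfl⟩
      · by_cases h : τ - β = τ
        · have : mono I τ = 0 := by
            rw [mono, Ideal.Quotient.eq_zero_iff_mem, hI]
            exact Ideal.subset_span ⟨τ, hτ, rfl⟩
          rw [h, this]
          exact zero_mem _
        · exact Ideal.subset_span ⟨_, Or.inr ⟨τ, hτ, h, rfl⟩, rfl⟩
    have : Ideal.Quotient.mk I (monomial α (coeff α x)) =
        Ideal.Quotient.mk I (monomial (α - (τ - β)) (coeff α x)) * mono I (τ - β) := by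
      rw [mono, ← map_mul, monomial_mul, mul_one, tsub_add_cancel_of_le hle]
    rw [this]
    exact Ideal.mul_mem_left _ _ hmem
  · rw [Ideal.span_le]
    rintro _ ⟨α, hα, rfl⟩
    rw [SetLike.mem_coe, Submodule.mem_colon_singleton, smul_eq_mul, mono_mul, mono, hlift,
      mem_ideal_span_monomial_image]
    intro ξ hξ
    rw [Finset.mem_singleton.1 (support_monomial_subset hξ)]
    rcases hα with ⟨τ, hτ, rfl⟩ | ⟨τ, hτ, -, rfl⟩
    exacts [⟨τ, Or.inl hτ, le_tsub_add⟩, ⟨τ, Or.inr hτ, le_tsub_add⟩]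

end MonomialRing

/-! ### Syzygies with prescribed leading coefficients -/

section LeadingSyzygies

variable {A : Type*} [CommRing A] {M : Type*} [AddCommGroup M] [Module A M] {ι : Type*}
  [LinearOrder ι] {κ : ι → Type*}

/-- The vectors `h l q` are relations among the `g l`, with coordinate `u l q` at the position `l` and
coordinates zero at the later positions, and the `u l q` generate the ideal of all leading coefficients at `l`
of relations, namely the colon ideal of `g l` with respect to the previous `g l'`. -/
structure IsLeadingSyzygies (g : ι → M) (u : ∀ l, κ l → A) (h : ∀ l, κ l → ι →₀ A) : Prop where
  mem_ker : ∀ l q, Finsupp.linearCombination A g (h l q) = 0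
  apply_self : ∀ l q, h l q l = u l q
  apply_of_lt : ∀ {l j} q, l < j → h l q j = 0
  colon_eq : ∀ l, (Submodule.span A (g '' {l' | l' < l})).colon {g l} = Ideal.span (Set.range (u l))

variable {g : ι → M} {u : ∀ l, κ l → A} {h : ∀ l, κ l → ι →₀ A}

/-- The leading coefficient of a relation lies in the colon ideal. -/
theorem apply_mem_colon_of_mem_ker {x : ι →₀ A} (hx : Finsupp.linearCombination A g x = 0) {l : ι}
    (hl : ∀ j, x j ≠ 0 → j ≤ l) :
    x l ∈ (Submodule.span A (g '' {l' | l' < l})).colon {g l} := by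
  rw [Submodule.mem_colon_singleton]
  have hadd := congrArg (Finsupp.linearCombination A g) (Finsupp.single_add_erase l x)
  rw [map_add, hx, Finsupp.linearCombination_single] at hadd
  rw [eq_neg_of_add_eq_zero_left hadd]
  refine neg_mem ((Finsupp.mem_span_image_iff_linearCombination A).2 ⟨x.erase l, ?_, rfl⟩)
  rw [Finsupp.mem_supported]
  intro j hj
  rw [Finset.mem_coe, Finsupp.support_erase, Finset.mem_erase, Finsupp.mem_support_iff] at hj
  exact lt_of_le_of_ne (hl j hj.2) hj.1

/-- Leading syzygies generate all relations, and a relation involves only those whose leading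
position does not exceed its own: division with remainder by the leading coefficients. -/
theorem IsLeadingSyzygies.mem_span [WellFoundedLT ι] [∀ l, Finite (κ l)]
    (hh : IsLeadingSyzygies g u h) {x : ι →₀ A} (hx : Finsupp.linearCombination A g x = 0) :
    x ∈ Submodule.span A {y | ∃ l q, y = h l q ∧ ∃ j, x j ≠ 0 ∧ l ≤ j} := by
  have key : ∀ l, ∀ x : ι →₀ A, Finsupp.linearCombination A g x = 0 → (∀ j, x j ≠ 0 → j ≤ l) →
      x ∈ Submodule.span A {y | ∃ l' q, y = h l' q ∧ l' ≤ l} := by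
    intro l
    induction l using WellFoundedLT.induction with
    | ind l ih =>
    intro x hx hl
    have := Fintype.ofFinite (κ l)
    have hxl := apply_mem_colon_of_mem_ker hx hl
    rw [hh.colon_eq, Ideal.span, Submodule.mem_span_range_iff_exists_fun] at hxl
    obtain ⟨c, hc⟩ := hxl
    set z := ∑ q, c q • h l q with hz
    have hzmem : z ∈ Submodule.span A {y | ∃ l' q, y = h l' q ∧ l' ≤ l} :=
      sum_mem fun q _ => Submodule.smul_mem _ _ (Submodule.subset_span ⟨l, q, rfl, le_rfl⟩)
    have hzker : Finsupp.linearCombination A g z = 0 := by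
      simp [hz, map_sum, hh.mem_ker]
    have hlt : ∀ j, (x - z) j ≠ 0 → j < l := by
      intro j hj
      by_contra! hle
      refine hj ?_
      rcases hle.eq_or_lt with rfl | hlt
      · simp [hz, hh.apply_self, ← hc]
      · have : x j = 0 := by
          by_contra h0
          exact absurd (hl j h0) (not_le.2 hlt)
        simp [hz, hh.apply_of_lt _ hlt, this]
    suffices hsub : x - z ∈ Submodule.span A {y | ∃ l' q, y = h l' q ∧ l' ≤ l} by
      simpa using add_mem hsub hzmem
    by_cases h0 : x - z = 0
    · rw [h0]
      exact zero_mem _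
    · have hne := Finsupp.support_nonempty_iff.2 h0
      have hmax := hlt _ (Finsupp.mem_support_iff.1 ((x - z).support.max'_mem hne))
      refine Submodule.span_mono ?_ (ih _ hmax (x - z) (by rw [map_sub, hx, hzker, sub_zero])
        fun j hj => Finset.le_max' _ _ (Finsupp.mem_support_iff.2 hj))
      rintro _ ⟨l', q, rfl, hle⟩
      exact ⟨l', q, rfl, hle.trans hmax.le⟩
  by_cases h0 : x = 0
  · rw [h0]
    exact zero_mem _
  · have hne := Finsupp.support_nonempty_iff.2 h0
    refine Submodule.span_mono ?_ (key (x.support.max' hne) x hx fun j hj =>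
      Finset.le_max' _ _ (Finsupp.mem_support_iff.2 hj))
    rintro _ ⟨l', q, rfl, hle⟩
    exact ⟨l', q, rfl, _, Finsupp.mem_support_iff.1 (x.support.max'_mem hne), hle⟩

theorem IsLeadingSyzygies.span_eq_ker [WellFoundedLT ι] [∀ l, Finite (κ l)]
    (hh : IsLeadingSyzygies g u h) :
    Submodule.span A (Set.range fun i : Σₗ l, κ l => h i.1 i.2) =
      LinearMap.ker (Finsupp.linearCombination A g) := by
  apply le_antisymm
  · rw [Submodule.span_le]
    rintro _ ⟨i, rfl⟩
    exact hh.mem_ker _ _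
  · intro x hx
    refine Submodule.span_mono ?_ (hh.mem_span hx)
    rintro _ ⟨l, q, rfl, -⟩
    exact ⟨toLex ⟨l, q⟩, rfl⟩

/-- In the lexicographic order, the colon ideals of the leading syzygies are those of their leading
coefficients at the same position. -/
theorem IsLeadingSyzygies.colon_syzygies [WellFoundedLT ι] [∀ l, LinearOrder (κ l)]
    [∀ l, Finite (κ l)] (hh : IsLeadingSyzygies g u h) (i : Σₗ l, κ l) :
    (Submodule.span A ((fun i : Σₗ l, κ l => h i.1 i.2) '' {i' | i' < i})).colon {h i.1 i.2} =
      (Ideal.span (u i.1 '' {q | q < i.2})).colon {u i.1 i.2} := by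
  obtain ⟨l, q⟩ := i
  change (Submodule.span A ((fun i : Σₗ l, κ l => h i.1 i.2) '' {i' | i' < toLex ⟨l, q⟩})).colon
    {h l q} = (Ideal.span (u l '' {q' | q' < q})).colon {u l q}
  ext c
  rw [Submodule.mem_colon_singleton, Submodule.mem_colon_singleton]
  constructor
  · intro hc
    have hle : Submodule.span A ((fun i : Σₗ l, κ l => h i.1 i.2) '' {i' | i' < toLex ⟨l, q⟩}) ≤
        Submodule.comap (Finsupp.lapply l : (ι →₀ A) →ₗ[A] A)
          (Ideal.span (u l '' {q' | q' < q})) := by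
      rw [Submodule.span_le]
      rintro _ ⟨⟨l', q'⟩, hlt, rfl⟩
      change h l' q' l ∈ Ideal.span (u l '' {q' | q' < q})
      rcases Sigma.Lex.lt_def.1 hlt with hlt | ⟨heq, hlt⟩
      · rw [hh.apply_of_lt q' (show l' < l from hlt)]
        exact zero_mem _
      · obtain rfl : l' = l := heq
        rw [hh.apply_self]
        exact Ideal.subset_span ⟨q', hlt, rfl⟩
    have := hle hc
    rwa [Submodule.mem_comap, map_smul, Finsupp.lapply_apply, hh.apply_self] at this
  · intro hc
    obtain ⟨b, hb, hbc⟩ := (Finsupp.mem_span_image_iff_linearCombination A).1 hc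
    set z := Finsupp.linearCombination A (h l) b with hz
    have hzmem : z ∈ Submodule.span A
        ((fun i : Σₗ l, κ l => h i.1 i.2) '' {i' | i' < toLex ⟨l, q⟩}) := by
      refine Submodule.span_mono ?_
        ((Finsupp.mem_span_image_iff_linearCombination A).2 ⟨b, hb, rfl⟩)
      rintro _ ⟨q', hq', rfl⟩
      exact ⟨toLex ⟨l, q'⟩, Sigma.Lex.lt_def.2 (Or.inr ⟨rfl, hq'⟩), rfl⟩
    have hzapp : ∀ j, z j = Finsupp.linearCombination A (fun q' => h l q' j) b := fun j => by
      rw [hz, ← Finsupp.lapply_apply (R := A), Finsupp.apply_linearCombination]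
      rfl
    have hker : Finsupp.linearCombination A g (c • h l q - z) = 0 := by
      rw [map_sub, map_smul, hh.mem_ker, smul_zero, zero_sub, hz,
        Finsupp.apply_linearCombination, neg_eq_zero]
      simp [Finsupp.linearCombination_apply, hh.mem_ker]
    have hlt : ∀ j, (c • h l q - z) j ≠ 0 → j < l := by
      intro j hj
      by_contra! hle
      refine hj ?_
      rw [Finsupp.sub_apply, Finsupp.smul_apply, hzapp]
      rcases hle.eq_or_lt with rfl | hlt
      · simp only [hh.apply_self]
        rw [← hbc]
        exact sub_self _
      · simp [Finsupp.linearCombination_apply, hh.apply_of_lt _ hlt]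
    have hsub : c • h l q - z ∈ Submodule.span A
        ((fun i : Σₗ l, κ l => h i.1 i.2) '' {i' | i' < toLex ⟨l, q⟩}) := by
      refine Submodule.span_mono ?_ (hh.mem_span hker)
      rintro _ ⟨l', q', rfl, j, hj, hle⟩
      exact ⟨toLex ⟨l', q'⟩, Sigma.Lex.lt_def.2 (Or.inl (hle.trans_lt (hlt j hj))), rfl⟩
    simpa using add_mem hsub hzmem

end LeadingSyzygies

/-! ### Resolutions with monomial colon ideals -/

section Resolution

open MvPolynomial

variable {k : Type*} [Field k] {r : ℕ} {I : Ideal (MvPolynomial (Fin r) k)}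
  {Γ : Type*} [AddCommGroup Γ] {φ : (Fin r →₀ ℕ) → Γ}

/-- The colon ideals of the members of the family `g` with respect to the previous ones are
generated by monomials whose exponents satisfy `p`. -/
def HasMonomialColons (I : Ideal (MvPolynomial (Fin r) k)) {ι : Type*} [LinearOrder ι] {M : Type*}
    [AddCommGroup M] [Module (MvPolynomial (Fin r) k ⧸ I) M] (g : ι → M)
    (p : (Fin r →₀ ℕ) → Prop) : Prop :=
  ∀ l, ∃ Y : Set (Fin r →₀ ℕ),
    (Submodule.span (MvPolynomial (Fin r) k ⧸ I) (g '' {l' | l' < l})).colon {g l} =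
      Ideal.span (mono I '' Y) ∧ ∀ α ∈ Y, p α

/-- An ideal generated by monomials is generated by finitely many of them. -/
theorem exists_fin_span_mono (Y : Set (Fin r →₀ ℕ)) :
    ∃ (n : ℕ) (m : Fin n → Fin r →₀ ℕ), (∀ q, m q ∈ Y) ∧
      Ideal.span (mono I '' Y) = Ideal.span (Set.range fun q => mono I (m q)) := by
  obtain ⟨T, hT, hspan⟩ := (Submodule.fg_span_iff_fg_span_finset_subset (mono I '' Y)).1
    (IsNoetherian.noetherian (R := MvPolynomial (Fin r) k ⧸ I) _)
  choose! m hmY hm using fun x (hx : x ∈ T) => hT hx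
  refine ⟨T.card, fun q => m (T.equivFin.symm q), fun q => hmY _ (T.equivFin.symm q).2, ?_⟩
  rw [Ideal.span, hspan]
  congr 1
  ext x
  constructor
  · exact fun hx => ⟨T.equivFin ⟨x, hx⟩, by simp [hm x hx]⟩
  · rintro ⟨q, rfl⟩
    simp only [hm _ (T.equivFin.symm q).2]
    exact (T.equivFin.symm q).2

/-- A monomial in the colon ideal of `g l` is the leading coefficient of a homogeneous relation. -/
theorem exists_homogeneous_syzygy
    {π : Γ → (MvPolynomial (Fin r) k ⧸ I) →+ (MvPolynomial (Fin r) k ⧸ I)}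
    (hπ : IsRingProjection (ringPiece I φ) π) {M : Type*} [AddCommGroup M]
    [Module (MvPolynomial (Fin r) k ⧸ I) M] {𝓜 : Γ → AddSubgroup M} (hM : HasProjection π 𝓜)
    {ι : Type*} [LinearOrder ι] {g : ι → M} {deg : ι → Γ} (hg : ∀ j, g j ∈ 𝓜 (deg j)) {l : ι}
    {α : Fin r →₀ ℕ} (hα : mono I α ∈
      (Submodule.span (MvPolynomial (Fin r) k ⧸ I) (g '' {l' | l' < l})).colon {g l}) :
    ∃ h : ι →₀ (MvPolynomial (Fin r) k ⧸ I), h ∈ freePiece (ringPiece I φ) deg (φ α + deg l) ∧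
      Finsupp.linearCombination (MvPolynomial (Fin r) k ⧸ I) g h = 0 ∧ h l = mono I α ∧
      ∀ j, l < j → h j = 0 := by
  rw [Submodule.mem_colon_singleton, Finsupp.mem_span_image_iff_linearCombination] at hα
  obtain ⟨c, hc, hcα⟩ := hα
  -- The relation is first found without regard to degrees, then replaced by its component.
  let x := Finsupp.single l (mono I α) - c
  have hx : Finsupp.linearCombination (MvPolynomial (Fin r) k ⧸ I) g x = 0 := by
    rw [map_sub, Finsupp.linearCombination_single, hcα, sub_self]
  have hc0 : ∀ j, l ≤ j → c j = 0 := fun j hj => by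
    by_contra h
    exact absurd (hc (Finsupp.mem_support_iff.2 h)) (not_lt.2 hj)
  refine ⟨freeProj π deg (φ α + deg l) x, hπ.freeProj_mem _ _ _, ?_, ?_, fun j hj => ?_⟩
  · rw [hM.linearCombination_freeProj hg (by rw [hx]; exact zero_mem _), hx]
  · rw [freeProj_apply, add_sub_cancel_right, Finsupp.sub_apply, Finsupp.single_eq_same,
      hc0 l le_rfl, sub_zero, hπ.eq_self (mono_mem_ringPiece I φ α)]
  · rw [freeProj_apply, Finsupp.sub_apply, hc0 j hj.le, Finsupp.single_eq_of_ne hj.ne', sub_zero,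
      map_zero]

theorem weight_tsub_le {W : (Fin r →₀ ℕ) → ℝ} (hW : ∀ α β, W (α + β) = W α + W β)
    (hpos : ∀ α, 0 ≤ W α) (α β : Fin r →₀ ℕ) : W (α - β) ≤ W α := by
  have h : α - β + (α - (α - β)) = α := add_tsub_cancel_of_le tsub_le_self
  have := hW (α - β) (α - (α - β))
  rw [h] at this
  linarith [hpos (α - (α - β))]

/-- The relations among generators with monomial colon ideals are again generated by a family with
monomial colon ideals, and only the weights of the colon generators of the first family and of the
proper divisors of the generators of `I` enter the bounds. -/
theorem exists_syzygy_generators {G : Set (Fin r →₀ ℕ)}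
    (hI : I = Ideal.span ((fun α => monomial α (1 : k)) '' G))
    {π : Γ → (MvPolynomial (Fin r) k ⧸ I) →+ (MvPolynomial (Fin r) k ⧸ I)}
    (hπ : IsRingProjection (ringPiece I φ) π) (hφ : ∀ α β, φ (α + β) = φ α + φ β)
    {wt : Γ → ℝ} (hwt : ∀ a b, wt (a + b) = wt a + wt b) (hpos : ∀ α, 0 ≤ wt (φ α)) {f : ℝ}
    (hf : ∀ n ∈ G, ∀ m ≤ n, m ≠ n → wt (φ m) ≤ f)
    {M : Type*} [AddCommGroup M] [Module (MvPolynomial (Fin r) k ⧸ I) M] {𝓜 : Γ → AddSubgroup M}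
    (hM : HasProjection π 𝓜) {ι : Type} [LinearOrder ι] [Finite ι] {g : ι → M} {deg : ι → Γ}
    (hg : ∀ j, g j ∈ 𝓜 (deg j)) {d e : ℝ} (hd : ∀ j, wt (deg j) ≤ d)
    (hcolon : HasMonomialColons I g fun α => wt (φ α) ≤ e ∧ wt (φ α) ≤ f) :
    ∃ (κ : Type) (_ : LinearOrder κ) (_ : Finite κ) (h : κ → ι →₀ (MvPolynomial (Fin r) k ⧸ I))
      (deg' : κ → Γ), (∀ i, h i ∈ freePiece (ringPiece I φ) deg (deg' i)) ∧
        (∀ i, wt (deg' i) ≤ d + e) ∧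
        Submodule.span (MvPolynomial (Fin r) k ⧸ I) (Set.range h) =
          LinearMap.ker (Finsupp.linearCombination (MvPolynomial (Fin r) k ⧸ I) g) ∧
        HasMonomialColons I h fun α => wt (φ α) ≤ f := by
  choose Y hY hYwt using hcolon
  choose p m hmY hm using fun l => exists_fin_span_mono (I := I) (Y l)
  have hsyz : ∀ l (q : Fin (p l)), ∃ h : ι →₀ (MvPolynomial (Fin r) k ⧸ I),
      h ∈ freePiece (ringPiece I φ) deg (φ (m l q) + deg l) ∧
      Finsupp.linearCombination (MvPolynomial (Fin r) k ⧸ I) g h = 0 ∧ h l = mono I (m l q) ∧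
      ∀ j, l < j → h j = 0 := fun l q => exists_homogeneous_syzygy hπ hM hg (by
        rw [hY]
        exact Ideal.subset_span ⟨_, hmY l q, rfl⟩)
  choose h hdeg hker hself hlt using hsyz
  have hh : IsLeadingSyzygies g (fun l q => mono I (m l q)) h :=
    ⟨hker, hself, fun {l j} q hj => hlt l q j hj, fun l => by rw [hY, hm]⟩
  have : Finite (Σₗ l, Fin (p l)) := inferInstanceAs (Finite (Σ l, Fin (p l)))
  refine ⟨Σₗ l, Fin (p l), inferInstance, this, fun i => h i.1 i.2,
    fun i => φ (m i.1 i.2) + deg i.1, fun i => hdeg _ _, fun i => ?_, hh.span_eq_ker, fun i => ?_⟩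
  · rw [hwt]
    linarith [hd i.1, (hYwt _ _ (hmY i.1 i.2)).1]
  · refine ⟨{α | ∃ τ ∈ m i.1 '' {q | q < i.2}, α = τ - m i.1 i.2} ∪
      {α | ∃ n ∈ G, α ≠ n ∧ α = n - m i.1 i.2}, (hh.colon_syzygies i).trans ?_, ?_⟩
    · rw [← colon_span_mono hI, Set.image_image]
    · have hW : ∀ α β, wt (φ (α + β)) = wt (φ α) + wt (φ β) := fun α β => by rw [hφ, hwt]
      rintro _ (⟨_, ⟨q, -, rfl⟩, rfl⟩ | ⟨n, hn, hne, rfl⟩)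
      · exact (weight_tsub_le hW hpos _ _).trans (hYwt _ _ (hmY i.1 q)).2
      · exact hf n hn _ tsub_le_self hne

/-- A stage of the construction of a resolution: a graded free module and the submodule that remains
to be resolved. -/
structure Stage (A : Type*) [CommRing A] (Γ : Type*) where
  ι : Type
  deg : ι → Γ
  N : Submodule A (ι →₀ A)

/-- A module with homogeneous generators of weight `≤ d` whose colon ideals are generated by
monomials of weight `≤ e` and `≤ f` has a graded free resolution with basis elements of weight
`≤ d + e + n f` in position `n + 1`. -/
theorem exists_resolution_of_hasMonomialColons {G : Set (Fin r →₀ ℕ)}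
    (hI : I = Ideal.span ((fun α => monomial α (1 : k)) '' G))
    {π : Γ → (MvPolynomial (Fin r) k ⧸ I) →+ (MvPolynomial (Fin r) k ⧸ I)}
    (hπ : IsRingProjection (ringPiece I φ) π) (hφ : ∀ α β, φ (α + β) = φ α + φ β)
    {wt : Γ → ℝ} (hwt : ∀ a b, wt (a + b) = wt a + wt b) (hpos : ∀ α, 0 ≤ wt (φ α)) {f : ℝ}
    (hf : ∀ n ∈ G, ∀ m ≤ n, m ≠ n → wt (φ m) ≤ f)
    {M : Type*} [AddCommGroup M] [Module (MvPolynomial (Fin r) k ⧸ I) M] {𝓜 : Γ → AddSubgroup M}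
    (hM : HasProjection π 𝓜) {ι : Type} [LinearOrder ι] [Finite ι] {g : ι → M} {deg : ι → Γ}
    (hg : ∀ j, g j ∈ 𝓜 (deg j)) {d e : ℝ} (hd : ∀ j, wt (deg j) ≤ d)
    (hspan : Submodule.span (MvPolynomial (Fin r) k ⧸ I) (Set.range g) = ⊤)
    (hcolon : HasMonomialColons I g fun α => wt (φ α) ≤ e ∧ wt (φ α) ≤ f) :
    ∃ P : GradedFreeResolution.{_, _, _, 0} (ringPiece I φ) 𝓜,
      ∀ n j, wt (P.deg (n + 1) j) ≤ d + e + n * f := by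
  let A := MvPolynomial (Fin r) k ⧸ I
  obtain ⟨x, hx0, -, hR⟩ := exists_seq_of_forall_exists_step (T := fun _ => Stage A Γ)
    (fun n x => ∃ (κ : Type) (_ : LinearOrder κ) (_ : Finite κ) (h : κ → x.ι →₀ A) (deg' : κ → Γ),
      (∀ i, h i ∈ freePiece (ringPiece I φ) x.deg (deg' i)) ∧
      (∀ i, wt (deg' i) ≤ d + e + n * f) ∧ Submodule.span A (Set.range h) = x.N ∧
      HasMonomialColons I h fun α => wt (φ α) ≤ f)
    (fun n x y => ∃ D : (y.ι →₀ A) →ₗ[A] (x.ι →₀ A),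
      (∀ i, D (Finsupp.single i 1) ∈ freePiece (ringPiece I φ) x.deg (y.deg i)) ∧
      (∀ i, wt (y.deg i) ≤ d + e + n * f) ∧ LinearMap.range D = x.N ∧ LinearMap.ker D = y.N)
    (x₀ := ⟨ι, deg, LinearMap.ker (Finsupp.linearCombination A g)⟩)
    (by simpa using exists_syzygy_generators hI hπ hφ hwt hpos hf hM hg hd hcolon)
    (by
      rintro n x ⟨κ, _, _, h, deg', hh, hwt', hN, hc⟩
      refine ⟨⟨κ, deg', LinearMap.ker (Finsupp.linearCombination A h)⟩, ?_,
        Finsupp.linearCombination A h, fun i => ?_, hwt', ?_, rfl⟩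
      · obtain ⟨κ', o, fin, h', deg'', h1, h2, h3⟩ := exists_syzygy_generators hI hπ hφ hwt hpos hf
          (hπ.hasProjection_freePiece _) hh hwt' (e := f) (by simpa using hc)
        refine ⟨κ', o, fin, h', deg'', h1, fun i => (h2 i).trans_eq ?_, h3⟩
        push_cast
        ring
      · simpa using hh i
      · rw [Finsupp.range_linearCombination, hN])
  choose D hD hwtD hrange hker using hR
  have hε : ∃ ε : ((x 0).ι →₀ A) →ₗ[A] M, (∀ j, ε (Finsupp.single j 1) ∈ 𝓜 ((x 0).deg j)) ∧
      Function.Surjective ε ∧ (x 0).N = LinearMap.ker ε := by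
    rw [hx0]
    refine ⟨Finsupp.linearCombination A g, fun j => by simpa using hg j, ?_, rfl⟩
    rw [← LinearMap.range_eq_top, Finsupp.range_linearCombination, hspan]
  obtain ⟨ε, hε, hsurj, hN⟩ := hε
  exact ⟨⟨fun n => (x n).ι, fun n => (x n).deg, D, ε, hD, hε, hsurj, by rw [hrange, hN],
    fun n => by rw [hrange, hker]⟩, hwtD⟩

/-- The bound on the degrees of `Tor` for a module whose generators have monomial colon ideals. -/
theorem t_le_of_hasMonomialColons {G : Set (Fin r →₀ ℕ)}
    (hI : I = Ideal.span ((fun α => monomial α (1 : k)) '' G))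
    {π : Γ → (MvPolynomial (Fin r) k ⧸ I) →+ (MvPolynomial (Fin r) k ⧸ I)}
    (hπ : IsRingProjection (ringPiece I φ) π) (hφ : ∀ α β, φ (α + β) = φ α + φ β) (hφ0 : φ 0 = 0)
    {wt : Γ → ℝ} (hwt : ∀ a b, wt (a + b) = wt a + wt b) (hpos : ∀ α, 0 ≤ wt (φ α)) {f : ℝ}
    (hf : ∀ n ∈ G, ∀ m ≤ n, m ≠ n → wt (φ m) ≤ f)
    {M : Type*} [AddCommGroup M] [Module (MvPolynomial (Fin r) k ⧸ I) M] {𝓜 : Γ → AddSubgroup M}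
    (hM : HasProjection π 𝓜) {ι : Type} [LinearOrder ι] [Finite ι] {g : ι → M} {deg : ι → Γ}
    (hg : ∀ j, g j ∈ 𝓜 (deg j)) {d e : ℝ} (hd : ∀ j, wt (deg j) ≤ d)
    (hspan : Submodule.span (MvPolynomial (Fin r) k ⧸ I) (Set.range g) = ⊤)
    (hcolon : HasMonomialColons I g fun α => wt (φ α) ≤ e ∧ wt (φ α) ≤ f)
    (F : GradedFreeResolution (ringPiece I φ) 𝓜) {i : ℕ} (hi : 1 ≤ i) :
    F.t (irrelevant I) wt i ≤ ((d + e + ((i : ℝ) - 1) * f : ℝ) : EReal) := by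
  obtain ⟨n, rfl⟩ := Nat.exists_eq_add_of_le' hi
  obtain ⟨P, hP⟩ :=
    exists_resolution_of_hasMonomialColons hI hπ hφ hwt hpos hf hM hg hd hspan hcolon
  refine iSup₂_le fun γ hγ => EReal.coe_le_coe_iff.2 ?_
  by_contra! hlt
  refine hγ (F.torPiece_eq_bot hπ hM
    (fun δ hδ x hx => mem_irrelevant_of_mem_ringPiece hφ0 hδ hx) P n γ ?_)
  rintro j rfl
  have := hP n j
  push_cast at hlt
  linarith

end Resolution

/-! ### Multidegrees and total degrees -/

section Degrees

open MvPolynomial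

variable {k : Type*} [Field k] {r : ℕ} {I : Ideal (MvPolynomial (Fin r) k)}

theorem multidegree_add (α β : Fin r →₀ ℕ) :
    multidegree (α + β) = multidegree α + multidegree β := by
  ext j
  simp [multidegree]

theorem multidegree_injective : Function.Injective (multidegree (r := r)) := fun α β h => by
  ext j
  exact Int.ofNat_inj.1 (congrFun h j)

theorem weight_add (w : Fin r → ℝ) (a b : Fin r → ℤ) :
    weight w (a + b) = weight w a + weight w b := by
  simp [weight, mul_add, Finset.sum_add_distrib]

theorem totalDegree_add (α β : Fin r →₀ ℕ) :
    totalDegree (α + β) = totalDegree α + totalDegree β := by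
  simp [totalDegree, Finset.sum_add_distrib]

theorem totalDegree_lt_of_le_of_ne {m n : Fin r →₀ ℕ} (hle : m ≤ n) (hne : m ≠ n) :
    totalDegree m < totalDegree n := by
  obtain ⟨j, hj⟩ := DFunLike.ne_iff.1 hne
  exact Finset.sum_lt_sum (fun i _ => Int.ofNat_le.2 (hle i))
    ⟨j, Finset.mem_univ j, Int.ofNat_lt.2 (lt_of_le_of_ne (hle j) hj)⟩

/-- A multihomogeneous element of the ring is a scalar multiple of a monomial. -/
theorem eq_zero_or_exists_eq_smul_mono {b : Fin r → ℤ} {x : MvPolynomial (Fin r) k ⧸ I}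
    (hx : x ∈ ringPiece I multidegree b) :
    x = 0 ∨ ∃ α, multidegree α = b ∧ ∃ c : k, c ≠ 0 ∧ x = c • mono I α := by
  change x ∈ Submodule.span k _ at hx
  by_cases h : ∃ α, multidegree α = b
  · obtain ⟨α, rfl⟩ := h
    have : {β | multidegree β = multidegree α} = {α} := by
      ext β
      exact multidegree_injective.eq_iff
    rw [this, Set.image_singleton, Submodule.mem_span_singleton] at hx
    obtain ⟨c, rfl⟩ := hx
    by_cases hc : c = 0
    · exact Or.inl (by rw [hc, zero_smul])
    · exact Or.inr ⟨α, rfl, c, hc, rfl⟩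
  · have : {β | multidegree β = b} = ∅ := by
      ext β
      exact ⟨fun hβ => h ⟨β, hβ⟩, fun hβ => hβ.elim⟩
    rw [this, Set.image_empty, Submodule.span_empty] at hx
    exact Or.inl hx

/-- An ideal generated by multihomogeneous elements is generated by monomials of the same
degrees. -/
theorem exists_span_mono_of_multihomogeneous {X : Set (MvPolynomial (Fin r) k ⧸ I)}
    {p : (Fin r → ℤ) → Prop} (hX : ∀ x ∈ X, ∃ b, x ∈ ringPiece I multidegree b ∧ p b) :
    ∃ Y : Set (Fin r →₀ ℕ), Ideal.span X = Ideal.span (mono I '' Y) ∧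
      ∀ α ∈ Y, p (multidegree α) := by
  refine ⟨{α | p (multidegree α) ∧ mono I α ∈ Ideal.span X}, le_antisymm ?_ ?_, fun α h => h.1⟩
  · refine Ideal.span_le.2 fun x hx => ?_
    obtain ⟨b, hb, hp⟩ := hX x hx
    rcases eq_zero_or_exists_eq_smul_mono hb with rfl | ⟨α, rfl, c, hc, rfl⟩
    · exact zero_mem _
    · refine Submodule.smul_of_tower_mem _ c (Ideal.subset_span ⟨α, ⟨hp, ?_⟩, rfl⟩)
      rw [← inv_smul_smul₀ hc (mono I α)]
      exact Submodule.smul_of_tower_mem _ _ (Ideal.subset_span hx)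
  · rw [Ideal.span_le]
    rintro _ ⟨α, hα, rfl⟩
    exact hα.2

end Degrees

end MonomialSyzygies

theorem mainTheorem4 {k : Type u} [Field k] {r : ℕ}
    (I : Ideal (MvPolynomial (Fin r) k)) (G : Set (Fin r →₀ ℕ))
    (hI : I = Ideal.span ((fun α => MvPolynomial.monomial α (1 : k)) '' G)) :
    (∀ (w : Fin r → ℝ), (∀ j, 0 ≤ w j) →
      ∀ (M : Type v) [AddCommGroup M] [Module (MvPolynomial (Fin r) k ⧸ I) M]
        (𝓜 : (Fin r → ℤ) → AddSubgroup M),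
      MonomialSyzygies.IsGradedModule
        (MonomialSyzygies.ringPiece I MonomialSyzygies.multidegree) 𝓜 →
      ∀ (s : ℕ) (g : Fin s → M) (a : Fin s → Fin r → ℤ) (d e f : ℝ),
      (∀ l, g l ∈ 𝓜 (a l)) →
      (∀ l, MonomialSyzygies.weight w (a l) ≤ d) →
      Submodule.span (MvPolynomial (Fin r) k ⧸ I) (Set.range g) = ⊤ →
      (∀ l, ∃ X : Set (MvPolynomial (Fin r) k ⧸ I),
        (Submodule.span (MvPolynomial (Fin r) k ⧸ I) (g '' {l' | l' < l})).colon {g l}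
          = Ideal.span X ∧
        ∀ x ∈ X, ∃ b : Fin r → ℤ,
          x ∈ MonomialSyzygies.ringPiece I MonomialSyzygies.multidegree b ∧
          MonomialSyzygies.weight w b ≤ e ∧ MonomialSyzygies.weight w b ≤ f) →
      (∀ n ∈ G, ∀ m : Fin r →₀ ℕ, m ≤ n → m ≠ n →
        MonomialSyzygies.weight w (MonomialSyzygies.multidegree m) ≤ f) →
      ∀ (F : MonomialSyzygies.GradedFreeResolution.{u, 0, v, v₁}
          (MonomialSyzygies.ringPiece I MonomialSyzygies.multidegree) 𝓜) (i : ℕ), 1 ≤ i →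
        F.t (MonomialSyzygies.irrelevant I) (MonomialSyzygies.weight w) i
          ≤ ((d + e + ((i : ℝ) - 1) * f : ℝ) : EReal)) ∧
    (∀ f : ℕ, 2 ≤ f → (∀ n ∈ G, MonomialSyzygies.totalDegree n ≤ (f : ℤ)) →
      ∀ (F : MonomialSyzygies.GradedFreeResolution.{u, 0, u, v₂}
          (MonomialSyzygies.ringPiece I MonomialSyzygies.totalDegree)
          (MonomialSyzygies.degreeZeroPiece
            ((MvPolynomial (Fin r) k ⧸ I) ⧸ MonomialSyzygies.irrelevant I) (Γ := ℤ)))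
        (i : ℕ), 1 ≤ i →
        F.t (MonomialSyzygies.irrelevant I) (fun j : ℤ => (j : ℝ)) i
          ≤ ((1 + ((i : ℝ) - 1) * ((f : ℝ) - 1) : ℝ) : EReal)) := by
  refine ⟨fun w hw M _ _ 𝓜 hM s g a d e f hg hd hspan hcolon hf F i hi => ?_,
    fun f hf2 hf F i hi => ?_⟩
  · obtain ⟨π, hπ⟩ := MonomialSyzygies.exists_isRingProjection hI
      (MonomialSyzygies.multidegree_add (r := r))
    refine MonomialSyzygies.t_le_of_hasMonomialColons hI hπ MonomialSyzygies.multidegree_add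
      (by ext j; simp [MonomialSyzygies.multidegree]) (MonomialSyzygies.weight_add w)
      (fun α => Finset.sum_nonneg fun j _ => mul_nonneg (hw j) (by
        simp [MonomialSyzygies.multidegree])) hf
      (hM.hasProjection hπ) hg hd hspan (fun l => ?_) F hi
    obtain ⟨X, hX, hXwt⟩ := hcolon l
    rw [hX]
    exact MonomialSyzygies.exists_span_mono_of_multihomogeneous
      (p := fun b => MonomialSyzygies.weight w b ≤ e ∧ MonomialSyzygies.weight w b ≤ f) hXwt
  · obtain ⟨π, hπ⟩ := MonomialSyzygies.exists_isRingProjection hI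
      (MonomialSyzygies.totalDegree_add (r := r))
    have h0 : MonomialSyzygies.totalDegree (0 : Fin r →₀ ℕ) = 0 := by
      simp [MonomialSyzygies.totalDegree]
    have hf2 : (2 : ℝ) ≤ f := by exact_mod_cast hf2
    -- The residue field has one generator, of degree zero, whose annihilator is generated by the
    -- variables, which have degree `1 ≤ f - 1`.
    have key := MonomialSyzygies.t_le_of_hasMonomialColons hI hπ MonomialSyzygies.totalDegree_add
      h0 (wt := fun j : ℤ => (j : ℝ)) (fun a b => Int.cast_add a b)
      (fun α => by
        simp only [MonomialSyzygies.totalDegree]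
        exact_mod_cast Finset.sum_nonneg fun j _ => Int.natCast_nonneg (α j))
      (f := (f : ℝ) - 1)
      (fun n hn m hle hne => by
        have h1 := MonomialSyzygies.totalDegree_lt_of_le_of_ne hle hne
        have h2 : MonomialSyzygies.totalDegree m + 1 ≤ (f : ℤ) := by linarith [hf n hn]
        have h3 : (MonomialSyzygies.totalDegree m : ℝ) + 1 ≤ f := by exact_mod_cast h2
        linarith)
      (MonomialSyzygies.hasProjection_degreeZeroPiece h0 hπ)
      (g := fun _ : Unit => Ideal.Quotient.mk (MonomialSyzygies.irrelevant I) 1)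
      (deg := fun _ => 0) (fun _ h => absurd rfl h) (d := 0) (e := 1) (by simp)
      (by
        refine Submodule.eq_top_iff'.2 fun x => ?_
        obtain ⟨x, rfl⟩ := Ideal.Quotient.mk_surjective x
        rw [Set.range_const, Submodule.mem_span_singleton]
        exact ⟨x, congrArg (Ideal.Quotient.mk _) (mul_one x)⟩)
      (fun l => by
        refine ⟨Set.range fun j => Finsupp.single j 1, ?_, ?_⟩
        · ext x
          rw [← Set.range_comp, Submodule.mem_colon_singleton]
          have hempty : {l' : Unit | l' < l} = ∅ := by ext; simp
          rw [hempty, Set.image_empty, Submodule.span_empty, Submodule.mem_bot,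
            show x • Ideal.Quotient.mk (MonomialSyzygies.irrelevant I) 1 =
              Ideal.Quotient.mk (MonomialSyzygies.irrelevant I) (x * 1) from rfl, mul_one,
            Ideal.Quotient.eq_zero_iff_mem]
          rfl
        · rintro _ ⟨j, rfl⟩
          have h1 : MonomialSyzygies.totalDegree (Finsupp.single j 1) = 1 := by
            simp [MonomialSyzygies.totalDegree, Finsupp.single_apply]
          simp only [h1]
          constructor
          · simp
          · push_cast
            linarith)
      F hi
    rwa [zero_add] at key
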